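/- Let $A$ be a finite set of $m$ alternatives. A ranking is a strict linear order on $A$; a profile $R=(\succ_1,\dots,\succ_n)$ assigns a ranking to each of $n$ voters, and a social welfare function (SWF) $f$ maps every profile (for every number $n$ of voters) to a ranking. Let $\Delta(\succ,\rhd)=|\{(x,y)\in A^2: x\succ y\wedge y\rhd x\}|$ be the Kemeny distance, and let $u(\succ,\rhd)=\binom m2-\Delta(\succ,\rhd)=|\{(x,y)\in A^2: x\succ y\wedge x\rhd y\}|$ be the utility of a voter with ranking $\succ$ for $\rhd$. The incentive ratio of $f$ is $$\gamma_m(f)=\sup_{n,R,i,\succ_i'}\frac{u(\succ_i,f(\succ_i',R_{-i}))}{u(\succ_i,f(R))}\in[0,\infty],$$ where $(\succ_i',R_{-i})$ is obtained from $R$ by letting voter $i$ report $\succ_i'$, and $\frac x0=\infty$ for $x>0$, $\frac00=1$. Fix a ranking $\mathbf{>}$ of $A$. It is extended lexicographically to rankings: $x_1\dots x_m$ is preferred to $y_1\dots y_m$ if there is $\ell$ with $x_\ell\mathbf{>}y_\ell$ and $x_i=y_i$ for all $i<\ell$. Each of the following rules chooses, among the rankings described, the lexicographically most preferred one. - The Kemeny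 rule $f_{\mathit{Kemeny}}$: the rankings $\rhd$ minimizing $\sum_i\Delta(\succ_i,\rhd)$. - A distance scoring rule: the rankings $\rhd$ minimizing $\sum_i s(\Delta(\succ_i,\rhd))$, for a function $s:\{0,\dots,\binom m2\}\to\mathbb R$ with $s(x)>s(x-1)$ for all $1\le x\le\binom m2$ and $s(x)-s(x-1)\ge s(x-1)-s(x-2)$ for all $2\le x\le\binom m2$. - A positional scoring rule: the rankings $\rhd$ such that $x\rhd y$ implies $\sum_i p(r(\succ_i,x))\ge\sum_i p(r(\succ_i,y))$, where $r(\succ,x)=1+|\{y\in A\setminus\{x\}:y\succ x\}|$, for a function $p:\{1,\dots,m\}\to\mathbb R$ with $p(1)\ge\dots\ge p(m)$ and $p(1)>p(m)$. Then: 1. If $m\ge4$, then $\binom m2-m\le\gamma_m(f_{\mathit{Kemeny}})\le\binom m2$. 2. If $m\ge3$, then $\binom m2-1\le\gamma_m(f)\le\binom m2$ for every distance scoring rule $f\ne f_{\mathit{Kemeny}}$. 3. If $m\ge3$, then $\gamma_m(f)=\infty$ for every positional scoring rule $f$. -/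

import Mathlib

open scoped ENNReal

/-- A ranking of the alternatives: `r.prefers x y` means that `x` is ranked strictly above `y`.
It is the strict part of a transitive, antisymmetric and complete relation on `A`. -/
@[ext]
structure Ranking (A : Type*) where
  prefers : A → A → Prop
  trans : ∀ {x y z}, prefers x y → prefers y z → prefers x z
  asymm : ∀ {x y}, prefers x y → ¬ prefers y x
  total : ∀ {x y}, x ≠ y → prefers x y ∨ prefers y x

/-- A profile of `n` voters. -/
abbrev Profile (A : Type*) (n : ℕ) := Fin n → Ranking A

/-- A social welfare function, for all electorate sizes. -/
abbrev SWF (A : Type*) := ∀ n : ℕ, Profile A n → Ranking A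

namespace Ranking

variable {A : Type*}

instance [Finite A] : Finite (Ranking A) :=
  Finite.of_injective (fun r : Ranking A => r.prefers) fun _ _ h => Ranking.ext h

theorem irrefl (r : Ranking A) (x : A) : ¬ r.prefers x x := fun h => r.asymm h h

variable [Fintype A]

open Classical in
/-- The rank of `x` in `r`; the top alternative has rank `1`. -/
noncomputable def rank (r : Ranking A) (x : A) : ℕ :=
  1 + (Finset.univ.filter fun y => y ≠ x ∧ r.prefers y x).card

open Classical in
/-- The Kemeny distance. -/
noncomputable def kemenyDist (r r' : Ranking A) : ℕ :=
  (Finset.univ.filter fun p : A × A => r.prefers p.1 p.2 ∧ r'.prefers p.2 p.1).card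

open Classical in
/-- The utility of a voter with ranking `r` for `r'`: the number of agreeing pairs. -/
noncomputable def utility (r r' : Ranking A) : ℕ :=
  (Finset.univ.filter fun p : A × A => r.prefers p.1 p.2 ∧ r'.prefers p.1 p.2).card

/-- The utility is `(m choose 2)` minus the Kemeny distance. -/
theorem utility_add_kemenyDist (r r' : Ranking A) :
    r.utility r' + r.kemenyDist r' = (Fintype.card A).choose 2 := by
  classical
  have h1 : r.utility r' + r.kemenyDist r'
      = (Finset.univ.filter fun p : A × A => r.prefers p.1 p.2).card := by
    unfold utility kemenyDist
    rw [← Finset.card_union_of_disjoint]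
    · congr 1
      ext p
      simp only [Finset.mem_union, Finset.mem_filter, Finset.mem_univ, true_and]
      constructor
      · rintro (h | h) <;> exact h.1
      · intro h
        have hne : p.1 ≠ p.2 := fun e => r.irrefl p.2 (e ▸ h)
        rcases r'.total hne with h' | h'
        · exact Or.inl ⟨h, h'⟩
        · exact Or.inr ⟨h, h'⟩
    · rw [Finset.disjoint_filter]
      intro p _ h h'
      exact r'.asymm h.2 h'.2
  have h2 : (Finset.univ.filter fun p : A × A => r.prefers p.1 p.2).card
      = (Finset.univ.filter fun p : A × A => r.prefers p.2 p.1).card := by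
    apply Finset.card_bij (fun p _ => p.swap)
    · intro p hp
      simpa using hp
    · intro p _ q _ h
      exact Prod.swap_injective h
    · intro p hp
      exact ⟨p.swap, by simpa using hp, by simp⟩
  have h3 : (Finset.univ.filter fun p : A × A => r.prefers p.1 p.2).card
      + (Finset.univ.filter fun p : A × A => r.prefers p.2 p.1).card
      = (Finset.univ : Finset A).offDiag.card := by
    rw [← Finset.card_union_of_disjoint]
    · congr 1
      ext p
      simp only [Finset.mem_union, Finset.mem_filter, Finset.mem_univ, true_and,
        Finset.mem_offDiag]
      constructor
      · rintro (h | h) e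
        · exact r.irrefl p.2 (e ▸ h)
        · exact r.irrefl p.2 (e ▸ h)
      · exact fun h => r.total h
    · rw [Finset.disjoint_filter]
      intro p _ h h'
      exact r.asymm h h'
  rw [Finset.offDiag_card, Finset.card_univ] at h3
  rw [h1, Nat.choose_two_right, Nat.mul_sub, mul_one]
  omega

theorem rank_lt_of_prefers (r : Ranking A) {x y : A} (h : r.prefers x y) :
    r.rank x < r.rank y := by
  classical
  unfold rank
  refine Nat.add_lt_add_left (Finset.card_lt_card ?_) 1
  rw [Finset.ssubset_iff_of_subset]
  · refine ⟨x, ?_, by simp⟩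
    simp only [Finset.mem_filter, Finset.mem_univ, true_and]
    exact ⟨fun e => r.irrefl y (e ▸ h), h⟩
  · intro z
    simp only [Finset.mem_filter, Finset.mem_univ, true_and]
    intro hz
    have hzy := r.trans hz.2 h
    exact ⟨fun e => r.irrefl y (e ▸ hzy), hzy⟩

theorem rank_injective (r : Ranking A) : Function.Injective r.rank := by
  intro x y h
  by_contra hne
  rcases r.total hne with h' | h'
  · exact absurd h (r.rank_lt_of_prefers h').ne
  · exact absurd h (r.rank_lt_of_prefers h').ne'

theorem prefers_iff_rank_lt (r : Ranking A) {x y : A} :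
    r.prefers x y ↔ r.rank x < r.rank y := by
  refine ⟨r.rank_lt_of_prefers, fun h => ?_⟩
  have hne : x ≠ y := fun e => h.ne (e ▸ rfl)
  rcases r.total hne with h' | h'
  · exact h'
  · exact absurd (r.rank_lt_of_prefers h') (by omega)

theorem image_rank (r : Ranking A) :
    Finset.univ.image r.rank = Finset.Icc 1 (Fintype.card A) := by
  classical
  apply Finset.eq_of_subset_of_card_le
  · intro k hk
    obtain ⟨x, -, rfl⟩ := Finset.mem_image.1 hk
    have : (Finset.univ.filter fun y => y ≠ x ∧ r.prefers y x).card
        < (Finset.univ : Finset A).card := by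
      refine Finset.card_lt_card ?_
      rw [Finset.ssubset_iff_of_subset (Finset.filter_subset _ _)]
      exact ⟨x, Finset.mem_univ _, by simp⟩
    rw [Finset.card_univ] at this
    rw [Finset.mem_Icc]
    unfold rank
    omega
  · rw [Finset.card_image_of_injective _ r.rank_injective]
    simp

theorem exists_rank_eq (r r' : Ranking A) (x : A) : ∃ y, r'.rank y = r.rank x := by
  have h : r.rank x ∈ Finset.univ.image r'.rank := by
    rw [image_rank, ← r.image_rank]
    exact Finset.mem_image_of_mem _ (Finset.mem_univ x)
  obtain ⟨y, -, hy⟩ := Finset.mem_image.1 h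
  exact ⟨y, hy⟩

/-- `r` is lexicographically preferred to `r'` with respect to the external ranking `tb`:
for some position `ℓ`, both rankings have the same alternatives in all positions before `ℓ`,
and the alternative `x` that `r` has in position `ℓ` is ranked by `tb` above the alternative `y`
that `r'` has in position `ℓ`. -/
def LexPref (tb r r' : Ranking A) : Prop :=
  ∃ x y, r.rank x = r'.rank y ∧ tb.prefers x y ∧
    ∀ z, r.rank z < r.rank x → r'.rank z = r.rank z

theorem agree_symm {r r' : Ranking A} {x : A}
    (h : ∀ z, r.rank z < r.rank x → r'.rank z = r.rank z) :
    ∀ z, r'.rank z < r.rank x → r.rank z = r'.rank z := by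
  intro z hz
  obtain ⟨w, hw⟩ := exists_rank_eq r' r z
  have h' := h w (by omega)
  have : w = z := r'.rank_injective (by omega)
  rw [← this] at hw ⊢
  omega

theorem LexPref.trans {tb a b c : Ranking A} (h : LexPref tb a b) (h' : LexPref tb b c) :
    LexPref tb a c := by
  obtain ⟨x, y, hxy, ht, hag⟩ := h
  obtain ⟨y', z', hyz, ht', hag'⟩ := h'
  rcases lt_trichotomy (b.rank y) (b.rank y') with hlt | heq | hlt
  · refine ⟨x, y, ?_, ht, fun z hz => ?_⟩
    · rw [hag' y hlt, hxy]
    · have h1 := hag z hz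
      rw [hag' z (by omega), h1]
  · have e : y = y' := b.rank_injective heq
    subst e
    refine ⟨x, z', by omega, tb.trans ht ht', fun z hz => ?_⟩
    have h1 := hag z hz
    rw [hag' z (by omega), h1]
  · have hs := agree_symm hag
    have hy' := hs y' (by omega)
    refine ⟨y', z', by omega, ht', fun z hz => ?_⟩
    have h1 := hag z (by omega)
    rw [hag' z (by omega), h1]

theorem LexPref.irrefl (tb a : Ranking A) : ¬ LexPref tb a a := by
  rintro ⟨x, y, hxy, ht, -⟩
  rw [a.rank_injective hxy] at ht
  exact tb.irrefl y ht

theorem LexPref.total (tb : Ranking A) {a b : Ranking A} (hab : a ≠ b) :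
    LexPref tb a b ∨ LexPref tb b a := by
  classical
  have hne : (Finset.univ.filter fun x => b.rank x ≠ a.rank x).Nonempty := by
    by_contra hcon
    rw [Finset.not_nonempty_iff_eq_empty, Finset.filter_eq_empty_iff] at hcon
    apply hab
    ext x y
    have hx := not_not.1 (hcon (Finset.mem_univ x))
    have hy := not_not.1 (hcon (Finset.mem_univ y))
    rw [prefers_iff_rank_lt, prefers_iff_rank_lt, hx, hy]
  obtain ⟨x, hx, hmin⟩ := Finset.exists_min_image _ a.rank hne
  have hag : ∀ z, a.rank z < a.rank x → b.rank z = a.rank z := by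
    intro z hz
    by_contra hcon
    have := hmin z (by simpa using hcon)
    omega
  obtain ⟨y, hy⟩ := exists_rank_eq a b x
  have hxy : x ≠ y := by
    rintro rfl
    exact (Finset.mem_filter.1 hx).2 hy
  rcases tb.total hxy with h | h
  · exact Or.inl ⟨x, y, hy.symm, h, hag⟩
  · refine Or.inr ⟨y, x, hy, h, fun z hz => ?_⟩
    exact agree_symm hag z (by omega)

theorem exists_lexBest (tb : Ranking A) (S : Set (Ranking A)) (hS : S.Nonempty) :
    ∃ r ∈ S, ∀ r' ∈ S, r' ≠ r → LexPref tb r r' := by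
  have : IsTrans (Ranking A) (LexPref tb) := ⟨fun _ _ _ => LexPref.trans⟩
  have : Std.Irrefl (LexPref tb : Ranking A → Ranking A → Prop) := ⟨LexPref.irrefl tb⟩
  have wf : WellFounded (LexPref tb : Ranking A → Ranking A → Prop) :=
    Finite.wellFounded_of_trans_of_irrefl _
  refine ⟨wf.min S hS, wf.min_mem S hS, fun r' hr' hne => ?_⟩
  exact (LexPref.total tb hne).resolve_left (wf.not_lt_min S hr')

/-- The lexicographically most preferred ranking of a nonempty set of rankings. -/
noncomputable def lexBest (tb : Ranking A) (S : Set (Ranking A)) (hS : S.Nonempty) : Ranking A :=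
  Classical.choose (exists_lexBest tb S hS)

theorem lexBest_spec (tb : Ranking A) (S : Set (Ranking A)) (hS : S.Nonempty) :
    lexBest tb S hS ∈ S ∧ ∀ r' ∈ S, r' ≠ lexBest tb S hS → LexPref tb (lexBest tb S hS) r' :=
  Classical.choose_spec (exists_lexBest tb S hS)

end Ranking

section Rules

variable {A : Type*} [Fintype A]

/-- The rankings that minimize the total Kemeny distance to the input rankings. -/
def kemenyWinners {n : ℕ} (R : Profile A n) : Set (Ranking A) :=
  {r | ∀ r' : Ranking A, ∑ i, (R i).kemenyDist r ≤ ∑ i, (R i).kemenyDist r'}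

theorem kemenyWinners_nonempty (tb : Ranking A) {n : ℕ} (R : Profile A n) :
    (kemenyWinners R).Nonempty :=
  haveI : Nonempty (Ranking A) := ⟨tb⟩
  Finite.exists_min fun r : Ranking A => ∑ i, (R i).kemenyDist r

/-- The Kemeny rule, with ties broken lexicographically according to `tb`. -/
noncomputable def kemenyRule (tb : Ranking A) : SWF A := fun _ R =>
  Ranking.lexBest tb (kemenyWinners R) (kemenyWinners_nonempty tb R)

/-- `s`, restricted to `{0, …, (m choose 2)}`, is a distance scoring function: it is strictly
increasing and convex there. Values outside this range play no role. -/
def IsDistanceScoringFunction (m : ℕ) (s : ℕ → ℝ) : Prop :=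
  (∀ x, 1 ≤ x → x ≤ m.choose 2 → s (x - 1) < s x) ∧
  (∀ x, 2 ≤ x → x ≤ m.choose 2 → s (x - 1) - s (x - 2) ≤ s x - s (x - 1))

/-- The rankings that minimize the total score. -/
def distanceWinners (s : ℕ → ℝ) {n : ℕ} (R : Profile A n) : Set (Ranking A) :=
  {r | ∀ r' : Ranking A, ∑ i, s ((R i).kemenyDist r) ≤ ∑ i, s ((R i).kemenyDist r')}

theorem distanceWinners_nonempty (tb : Ranking A) (s : ℕ → ℝ) {n : ℕ} (R : Profile A n) :
    (distanceWinners s R).Nonempty :=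
  haveI : Nonempty (Ranking A) := ⟨tb⟩
  Finite.exists_min fun r : Ranking A => ∑ i, s ((R i).kemenyDist r)

/-- The rule induced by `s`, with ties broken lexicographically according to `tb`. -/
noncomputable def distanceRule (tb : Ranking A) (s : ℕ → ℝ) : SWF A := fun _ R =>
  Ranking.lexBest tb (distanceWinners s R) (distanceWinners_nonempty tb s R)

/-- `f` is a distance scoring rule (with tie-breaking according to `tb`). -/
def IsDistanceScoringRule (tb : Ranking A) (f : SWF A) : Prop :=
  ∃ s : ℕ → ℝ, IsDistanceScoringFunction (Fintype.card A) s ∧ f = distanceRule tb s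

/-- `p`, restricted to `{1, …, m}`, is a positional scoring function: it is non-increasing there
and not constant. Values outside this range play no role. -/
def IsPositionalScoringFunction (m : ℕ) (p : ℕ → ℝ) : Prop :=
  (∀ j k, 1 ≤ j → j ≤ k → k ≤ m → p k ≤ p j) ∧ p m < p 1

/-- The rankings that order the alternatives in decreasing order of their total scores. -/
def positionalWinners (p : ℕ → ℝ) {n : ℕ} (R : Profile A n) : Set (Ranking A) :=
  {r | ∀ x y, r.prefers x y → ∑ i, p ((R i).rank y) ≤ ∑ i, p ((R i).rank x)}

theorem positionalWinners_nonempty (tb : Ranking A) (p : ℕ → ℝ) {n : ℕ} (R : Profile A n) :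
    (positionalWinners p R).Nonempty := by
  set t : A → ℝ := fun x => ∑ i, p ((R i).rank x) with ht
  refine ⟨⟨fun x y => t y < t x ∨ (t y = t x ∧ tb.prefers x y), ?_, ?_, ?_⟩, ?_⟩
  · rintro x y z (h | ⟨h, h1⟩) (h' | ⟨h', h1'⟩)
    · exact Or.inl (h'.trans h)
    · exact Or.inl (h' ▸ h)
    · exact Or.inl (h ▸ h')
    · exact Or.inr ⟨h'.trans h, tb.trans h1 h1'⟩
  · rintro x y (h | ⟨h, h1⟩) (h' | ⟨h', h1'⟩)
    · exact lt_asymm h h'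
    · exact h.ne' h'
    · exact h'.ne' h
    · exact tb.asymm h1 h1'
  · intro x y hne
    rcases lt_trichotomy (t x) (t y) with h | h | h
    · exact Or.inr (Or.inl h)
    · rcases tb.total hne with h1 | h1
      · exact Or.inl (Or.inr ⟨h.symm, h1⟩)
      · exact Or.inr (Or.inr ⟨h, h1⟩)
    · exact Or.inl (Or.inl h)
  · rintro x y (h | ⟨h, -⟩)
    · exact h.le
    · exact h.le

/-- The rule induced by `p`, with ties broken lexicographically according to `tb`. -/
noncomputable def positionalRule (tb : Ranking A) (p : ℕ → ℝ) : SWF A := fun _ R =>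
  Ranking.lexBest tb (positionalWinners p R) (positionalWinners_nonempty tb p R)

/-- `f` is a positional scoring rule (with tie-breaking according to `tb`). -/
def IsPositionalScoringRule (tb : Ranking A) (f : SWF A) : Prop :=
  ∃ p : ℕ → ℝ, IsPositionalScoringFunction (Fintype.card A) p ∧ f = positionalRule tb p

/-- The ratio of two utilities, with `x / 0 = ∞` for `x > 0` and `0 / 0 = 1`. -/
noncomputable def utilityRatio (a b : ℕ) : ℝ≥0∞ :=
  if b = 0 then (if a = 0 then 1 else ∞) else (a : ℝ≥0∞) / (b : ℝ≥0∞)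

/-- The incentive ratio of `f`: the supremum, over all electorate sizes, profiles `R`, voters `i`
and misreports `r'`, of the ratio of the utilities of `i` after and before deviating to `r'`. -/
noncomputable def incentiveRatio (f : SWF A) : ℝ≥0∞ :=
  ⨆ (n : ℕ) (R : Profile A n) (i : Fin n) (r' : Ranking A),
    utilityRatio ((R i).utility (f n (Function.update R i r'))) ((R i).utility (f n R))

end Rules

/-! Write `M` for `m.choose 2`.

Upper bounds. If a voter's utility is zero, the outcome is the reversal of their ranking. By
convexity of `s`, no misreport raises the score of that reversal by more than it raises the score of
any other ranking, so the outcome stays put (`distanceRule_update_of_eq_rev`). Every other initial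
utility is at least 1, so the ratio is at most `M`.

Lower bounds for distance rules. Suppose some list of voters has exactly two optimal rankings, the
tie-breaking ranking `tb` and some `b` at distance `d`. After enough copies of it, two further
voters decide between `tb` and `b`. Let `t'` be `tb` with one adjacent pair flipped, a pair that `b`
also orders the other way. Voters `t'` and `t'.rev` leave `tb` chosen, with utility 1 for `t'.rev`;
reporting `tb.rev` instead of `t'.rev` moves the outcome to `b`, with utility `d - 1`
(`sub_one_le_incentiveRatio`). It remains to find lists with `d` large. If `s` is not affine, all
rankings except `tb` and `tb.rev` serve, with `b = tb.rev` and `d = M`. If `s` is affine, the rule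
is Kemeny's. There reversal pairs cancel, so any system of pairwise majorities of equal weight can
be built. A zigzag poset (fence) on a path, together with 3-cycles that tie the orders of its
incomparable pairs to each other, leaves only two optima, which agree on the `m - 1` edges and
nowhere else (`eq_or_eq_of_fence`, `utility_fence_le`).

Positional rules. The electorate of all rankings is a complete tie, resolved as `tb`. The voter
`tb.rev` has utility zero there, and a transposition of their report breaks the tie in favour of one
of their pairs (`exists_relabel_gain`). -/

/-! ### Reversal, relabelling and adjacent flips of rankings; the Kemeny metric. -/

namespace Ranking

variable {A : Type*}

/-- The reversed ranking. -/
def rev (r : Ranking A) : Ranking A where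
  prefers x y := r.prefers y x
  trans h h' := r.trans h' h
  asymm h := r.asymm h
  total h := (r.total h).symm

@[simp] theorem rev_prefers (r : Ranking A) (x y : A) : r.rev.prefers x y ↔ r.prefers y x :=
  Iff.rfl

@[simp] theorem rev_rev (r : Ranking A) : r.rev.rev = r := rfl

/-- The ranking by increasing values of an injective key. -/
def ofKey {α : Type*} [LinearOrder α] (k : A → α) (hk : Function.Injective k) : Ranking A where
  prefers x y := k x < k y
  trans h h' := h.trans h'
  asymm h := h.le.not_gt
  total h := lt_or_gt_of_ne (hk.ne h)

/-- The ranking transported along a permutation of the alternatives. -/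
def relabel (σ : Equiv.Perm A) (r : Ranking A) : Ranking A where
  prefers x y := r.prefers (σ x) (σ y)
  trans h h' := r.trans h h'
  asymm h := r.asymm h
  total h := r.total (σ.injective.ne h)

/-- Relabelling is a bijection on rankings. -/
def relabelEquiv (σ : Equiv.Perm A) : Ranking A ≃ Ranking A where
  toFun := relabel σ
  invFun := relabel σ.symm
  left_inv r := by ext; simp [relabel]
  right_inv r := by ext; simp [relabel]

theorem not_prefers_iff (r : Ranking A) {x y : A} (h : x ≠ y) :
    ¬ r.prefers x y ↔ r.prefers y x :=
  ⟨fun h' => (r.total h).resolve_left h', fun h' => r.asymm h'⟩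

theorem ne_of_prefers (r : Ranking A) {x y : A} (h : r.prefers x y) : x ≠ y :=
  fun e => r.irrefl y (e ▸ h)

theorem eq_of_imp {r r' : Ranking A} (h : ∀ x y, r.prefers x y → r'.prefers x y) : r = r' := by
  ext x y
  refine ⟨h x y, fun h' => ?_⟩
  by_contra hn
  exact r'.asymm h' (h y x ((r.not_prefers_iff (r'.ne_of_prefers h')).1 hn))

variable [Fintype A]

noncomputable instance : Fintype (Ranking A) := Fintype.ofFinite _

theorem rank_relabel (σ : Equiv.Perm A) (r : Ranking A) (x : A) :
    (relabel σ r).rank x = r.rank (σ x) := by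
  unfold rank
  congr 1
  refine Finset.card_bij (fun y _ => σ y) ?_ ?_ ?_
  · intro y hy
    simp only [Finset.mem_filter, Finset.mem_univ, true_and] at hy ⊢
    exact ⟨σ.injective.ne hy.1, hy.2⟩
  · intro _ _ _ _ h
    exact σ.injective h
  · intro y hy
    refine ⟨σ.symm y, ?_, by simp⟩
    simp only [Finset.mem_filter, Finset.mem_univ, true_and] at hy ⊢
    exact ⟨fun e => hy.1 (by simp [← e]), by simpa [relabel] using hy.2⟩

theorem kemenyDist_relabel (σ : Equiv.Perm A) (r r' : Ranking A) :
    (relabel σ r).kemenyDist (relabel σ r') = r.kemenyDist r' := by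
  unfold kemenyDist
  refine Finset.card_bij (fun p _ => (σ p.1, σ p.2)) ?_ ?_ ?_
  · intro p hp
    simp only [Finset.mem_filter, Finset.mem_univ, true_and] at hp ⊢
    exact hp
  · rintro ⟨a, b⟩ _ ⟨c, d⟩ _ h
    simpa using h
  · rintro ⟨a, b⟩ hp
    refine ⟨(σ.symm a, σ.symm b), ?_, by simp⟩
    simp only [Finset.mem_filter, Finset.mem_univ, true_and] at hp ⊢
    simpa [relabel] using hp

theorem exists_relabel_eq (r r' : Ranking A) : ∃ σ : Equiv.Perm A, relabel σ r = r' := by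
  choose g hg using exists_rank_eq r' r
  have hinj : Function.Injective g := fun x y h => r'.rank_injective (by rw [← hg, ← hg, h])
  refine ⟨Equiv.ofBijective g (Finite.injective_iff_bijective.1 hinj), ?_⟩
  ext x y
  change r.prefers (g x) (g y) ↔ _
  rw [prefers_iff_rank_lt, prefers_iff_rank_lt, hg, hg]

theorem kemenyDist_rev_left (r r' : Ranking A) : r.rev.kemenyDist r' = r.utility r' := by
  unfold kemenyDist utility
  refine Finset.card_bij (fun p _ => p.swap) ?_ ?_ ?_
  · intro p hp
    simpa using hp
  · intro _ _ _ _ h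
    exact Prod.swap_injective h
  · intro p hp
    exact ⟨p.swap, by simpa using hp, by simp⟩

theorem utility_rev_left (r r' : Ranking A) : r.rev.utility r' = r.kemenyDist r' := by
  rw [← kemenyDist_rev_left, rev_rev]

theorem kemenyDist_rev_right (r r' : Ranking A) : r.kemenyDist r'.rev = r.utility r' := rfl

theorem kemenyDist_comm (r r' : Ranking A) : r.kemenyDist r' = r'.kemenyDist r := by
  unfold kemenyDist
  refine Finset.card_bij (fun p _ => p.swap) ?_ ?_ ?_
  · intro p hp
    simpa [and_comm] using hp
  · intro _ _ _ _ h
    exact Prod.swap_injective h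
  · intro p hp
    exact ⟨p.swap, by simpa [and_comm] using hp, by simp⟩

theorem kemenyDist_eq_zero {r r' : Ranking A} : r.kemenyDist r' = 0 ↔ r = r' := by
  classical
  unfold kemenyDist
  rw [Finset.card_eq_zero, Finset.filter_eq_empty_iff]
  constructor
  · intro h
    refine eq_of_imp fun x y hxy => ?_
    by_contra hn
    exact h (Finset.mem_univ (x, y)) ⟨hxy, (r'.not_prefers_iff (r.ne_of_prefers hxy)).1 hn⟩
  · rintro rfl p - h
    exact r.asymm h.1 h.2

theorem kemenyDist_self (r : Ranking A) : r.kemenyDist r = 0 := kemenyDist_eq_zero.2 rfl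

theorem kemenyDist_rev_self (r : Ranking A) :
    r.rev.kemenyDist r = (Fintype.card A).choose 2 := by
  have := r.utility_add_kemenyDist r
  rw [kemenyDist_rev_left, ← this, kemenyDist_self, add_zero]

theorem eq_rev_of_utility_eq_zero {r r' : Ranking A} (h : r.utility r' = 0) : r' = r.rev := by
  rw [← kemenyDist_rev_left, kemenyDist_eq_zero] at h
  exact h.symm

theorem kemenyDist_le (r r' : Ranking A) : r.kemenyDist r' ≤ (Fintype.card A).choose 2 := by
  have := r.utility_add_kemenyDist r'
  omega

theorem utility_le (r r' : Ranking A) : r.utility r' ≤ (Fintype.card A).choose 2 := by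
  have := r.utility_add_kemenyDist r'
  omega

theorem kemenyDist_triangle (a b c : Ranking A) :
    a.kemenyDist c ≤ a.kemenyDist b + b.kemenyDist c := by
  classical
  unfold kemenyDist
  refine le_trans (Finset.card_le_card ?_) (Finset.card_union_le _ _)
  intro p
  simp only [Finset.mem_union, Finset.mem_filter, Finset.mem_univ, true_and]
  rintro ⟨h1, h2⟩
  rcases b.total (a.ne_of_prefers h1) with h | h
  · exact Or.inr ⟨h, h2⟩
  · exact Or.inl ⟨h1, h⟩

/-- At the first position where `r` and `tb` differ, `tb` has the best alternative not yet placed.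
So `tb` wins every tie it takes part in. -/
theorem not_lexPref_self (tb r : Ranking A) : ¬ LexPref tb r tb := by
  rintro ⟨x, y, hxy, ht, hag⟩
  have hlt := tb.rank_lt_of_prefers ht
  obtain ⟨w, hw⟩ := exists_rank_eq tb r x
  have h := hag w (by omega)
  have : w = x := tb.rank_injective (by omega)
  subst this
  omega

theorem lexBest_eq_self (tb : Ranking A) {S : Set (Ranking A)} (hS : S.Nonempty) (h : tb ∈ S) :
    lexBest tb S hS = tb := by
  by_contra hne
  exact not_lexPref_self tb _ ((lexBest_spec tb S hS).2 tb h fun e => hne e.symm)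

/-- Adjacency keeps the relation transitive when this one pair is reversed, and no other pair
contributes to the change of distance. -/
theorem exists_flip (t : Ranking A) {x y : A} (hxy : t.prefers x y)
    (hadj : ∀ z, t.prefers x z → ¬ t.prefers z y) :
    ∃ t' : Ranking A, ∀ r : Ranking A, r.prefers y x → t'.kemenyDist r + 1 = t.kemenyDist r := by
  classical
  have hne := t.ne_of_prefers hxy
  let t' : Ranking A :=
    { prefers := fun u v => (t.prefers u v ∧ ¬ (u = x ∧ v = y)) ∨ (u = y ∧ v = x)
      trans := by
        have h1 := @t.trans
        have h2 := @t.asymm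
        have h3 := @t.total
        intro u v w
        grind
      asymm := by
        have h2 := @t.asymm
        intro u v
        grind
      total := by
        have h3 := @t.total
        intro u v
        grind }
  refine ⟨t', fun r hr => ?_⟩
  unfold kemenyDist
  rw [← Finset.card_insert_of_notMem (a := (x, y))]
  · congr 1
    ext ⟨u, v⟩
    have h1 := @r.asymm
    have h2 := @t.asymm
    simp only [Finset.mem_insert, Finset.mem_filter, Finset.mem_univ, true_and, t', Prod.mk.injEq]
    grind
  · simp [t', hne]

/-- The complementary case follows from the hypothesis at `r.rev`, since distances to `r` and
`r.rev` sum to a constant. -/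
theorem kemenyDist_flip {t t' : Ranking A} {x y : A}
    (h : ∀ r : Ranking A, r.prefers y x → t'.kemenyDist r + 1 = t.kemenyDist r)
    {r : Ranking A} (hr : r.prefers x y) : t'.kemenyDist r = t.kemenyDist r + 1 := by
  have h1 := h r.rev hr
  rw [kemenyDist_rev_right, kemenyDist_rev_right] at h1
  have h2 := t.utility_add_kemenyDist r
  have h3 := t'.utility_add_kemenyDist r
  omega

end Ranking

open Ranking

/-! ### Convexity of distance scoring functions. -/

theorem kemenyRule_eq_distanceRule {A : Type*} [Fintype A] (tb : Ranking A) :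
    kemenyRule tb = distanceRule tb fun x => (x : ℝ) := by
  funext n R
  unfold kemenyRule distanceRule
  congr 1
  ext r
  simp only [kemenyWinners, distanceWinners, Set.mem_ofPred_eq]
  exact forall_congr' fun r' => by exact_mod_cast Iff.rfl

theorem isDistanceScoringFunction_natCast (m : ℕ) :
    IsDistanceScoringFunction m fun x => (x : ℝ) := by
  refine ⟨fun x hx _ => ?_, fun x hx _ => ?_⟩
  · simp only [Nat.cast_lt]
    omega
  · obtain ⟨y, rfl⟩ := Nat.exists_eq_add_of_le' hx
    simp only [Nat.add_sub_cancel, show y + 2 - 1 = y + 1 by omega]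
    push_cast
    linarith

namespace IsDistanceScoringFunction

variable {m : ℕ} {s : ℕ → ℝ}

theorem monotone (hs : IsDistanceScoringFunction m s) {a b : ℕ} (hab : a ≤ b)
    (hb : b ≤ m.choose 2) : s a ≤ s b := by
  induction b, hab using Nat.le_induction with
  | base => exact le_rfl
  | succ b _ ih =>
    have := hs.1 (b + 1) (by omega) hb
    simp only [Nat.add_sub_cancel] at this
    linarith [ih (by omega)]

theorem strictMono (hs : IsDistanceScoringFunction m s) {a b : ℕ} (hab : a < b)
    (hb : b ≤ m.choose 2) : s a < s b := by
  have h1 := hs.monotone (a := a) (b := b - 1) (by omega) (by omega)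
  linarith [hs.1 b (by omega) hb]

theorem slope_le (hs : IsDistanceScoringFunction m s) {a b : ℕ} (hab : a ≤ b)
    (hb : b + 1 ≤ m.choose 2) : s (a + 1) - s a ≤ s (b + 1) - s b := by
  induction b, hab using Nat.le_induction with
  | base => exact le_rfl
  | succ b _ ih =>
    have := hs.2 (b + 2) (by omega) hb
    simp only [Nat.add_sub_cancel, show b + 2 - 1 = b + 1 by omega] at this
    linarith [ih (by omega)]

theorem increment_le (hs : IsDistanceScoringFunction m s) {b c : ℕ} (hbc : b ≤ c) (e : ℕ)
    (hc : c + e ≤ m.choose 2) : s (b + e) - s b ≤ s (c + e) - s c := by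
  induction e with
  | zero => simp
  | succ e ih =>
    have h1 := hs.slope_le (a := b + e) (b := c + e) (by omega) (by omega)
    have h2 := ih (by omega)
    simp only [← add_assoc]
    linarith

/-- A convex increasing function grows most over the topmost interval of a given length. -/
theorem sub_le_top (hs : IsDistanceScoringFunction m s) {a b d : ℕ} (ha : a ≤ m.choose 2)
    (hb : b ≤ m.choose 2) (hab : a ≤ b + d) (hd : d ≤ m.choose 2) :
    s a - s b ≤ s (m.choose 2) - s (m.choose 2 - d) := by
  rcases le_total a b with h | h
  · have h1 := hs.monotone h hb
    have h2 := hs.monotone (Nat.sub_le (m.choose 2) d) le_rfl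
    linarith
  · have h1 := hs.increment_le (b := b) (c := m.choose 2 - (a - b)) (by omega) (a - b) (by omega)
    rw [Nat.sub_add_cancel (by omega), Nat.add_sub_cancel' h] at h1
    have h2 := hs.monotone (a := m.choose 2 - d) (b := m.choose 2 - (a - b)) (by omega) (by omega)
    linarith

/-- For a function that is not affine, the extreme pair of complementary distances is the most
expensive one. -/
theorem add_compl_lt (hs : IsDistanceScoringFunction m s)
    (hne : s 1 - s 0 < s (m.choose 2) - s (m.choose 2 - 1)) {d : ℕ} (hd : 0 < d)
    (hdm : d < m.choose 2) :
    s d + s (m.choose 2 - d) < s 0 + s (m.choose 2) := by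
  have h := hs.increment_le (b := 1) (c := m.choose 2 - d) (by omega) (d - 1) (by omega)
  rw [Nat.add_sub_cancel' hd, show m.choose 2 - d + (d - 1) = m.choose 2 - 1 by omega] at h
  linarith

/-- The slopes are non-decreasing, so a last slope not above the first forces all of them to
coincide. -/
theorem eq_affine (hs : IsDistanceScoringFunction m s)
    (h : s (m.choose 2) - s (m.choose 2 - 1) ≤ s 1 - s 0) {x : ℕ} (hx : x ≤ m.choose 2) :
    s x = s 0 + x * (s 1 - s 0) := by
  induction x with
  | zero => simp
  | succ x ih =>
    have h1 := hs.slope_le (a := 0) (b := x) (by omega) hx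
    have h2 := hs.slope_le (a := x) (b := m.choose 2 - 1) (by omega) (by omega)
    rw [Nat.sub_add_cancel (by omega)] at h2
    have h3 := ih (by omega)
    simp only [zero_add] at h1
    push_cast
    linarith

end IsDistanceScoringFunction

/-! ### Profiles that differ in one voter. -/

section

variable {A : Type*}

theorem sum_update (g : Ranking A → ℝ) {n : ℕ} (R : Profile A n) (i : Fin n) (v : Ranking A) :
    ∑ j, g (Function.update R i v j) = ∑ j, g (R j) + (g v - g (R i)) := by
  have h1 := Finset.add_sum_erase Finset.univ (fun j => g (Function.update R i v j))
    (Finset.mem_univ i)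
  have h2 := Finset.add_sum_erase Finset.univ (fun j => g (R j)) (Finset.mem_univ i)
  have h3 : ∑ j ∈ Finset.univ.erase i, g (Function.update R i v j)
      = ∑ j ∈ Finset.univ.erase i, g (R j) :=
    Finset.sum_congr rfl fun j hj => by rw [Function.update_of_ne (Finset.ne_of_mem_erase hj)]
  simp only [Function.update_self] at h1
  linarith

/-- The electorate that consists of a distinguished first voter and the voters of a list. -/
def consProfile (v : Ranking A) (L : List (Ranking A)) : Profile A (L.length + 1) :=
  Fin.cons v L.get

theorem sum_consProfile (g : Ranking A → ℝ) (v : Ranking A) (L : List (Ranking A)) :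
    ∑ i, g (consProfile v L i) = g v + (L.map g).sum := by
  rw [Fin.sum_univ_succ]
  simp only [consProfile, Fin.cons_zero, Fin.cons_succ]
  congr 1
  rw [← List.sum_ofFn]
  congr 1
  exact List.ofFn_getElem_eq_map L g

end

section

variable {A : Type*} [Fintype A]

theorem distanceRule_eq_kemenyRule (tb : Ranking A) {s : ℕ → ℝ}
    (hs : IsDistanceScoringFunction (Fintype.card A) s) (hM : 1 ≤ (Fintype.card A).choose 2)
    (h : s ((Fintype.card A).choose 2) - s ((Fintype.card A).choose 2 - 1) ≤ s 1 - s 0) :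
    distanceRule tb s = kemenyRule tb := by
  rw [kemenyRule_eq_distanceRule]
  funext n R
  unfold distanceRule
  congr 1
  have hpos : 0 < s 1 - s 0 := sub_pos.2 (hs.strictMono zero_lt_one hM)
  have key : ∀ r : Ranking A, ∑ i, s ((R i).kemenyDist r)
      = ∑ _i : Fin n, s 0 + (∑ i, ((R i).kemenyDist r : ℝ)) * (s 1 - s 0) := by
    intro r
    rw [Finset.sum_mul, ← Finset.sum_add_distrib]
    exact Finset.sum_congr rfl fun i _ => hs.eq_affine h (kemenyDist_le _ _)
  ext r
  simp only [distanceWinners, Set.mem_ofPred_eq, key, add_le_add_iff_left,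
    mul_le_mul_iff_left₀ hpos]

/-! ### The upper bound for distance scoring rules. -/

/-- A voter who receives the reversal of their ranking cannot change the outcome. -/
theorem distanceRule_update_of_eq_rev (tb : Ranking A) {s : ℕ → ℝ}
    (hs : IsDistanceScoringFunction (Fintype.card A) s) {n : ℕ} (R : Profile A n) (i : Fin n)
    (v : Ranking A) (h : distanceRule tb s n R = (R i).rev) :
    distanceRule tb s n (Function.update R i v) = (R i).rev := by
  obtain ⟨hwin, hlex⟩ := lexBest_spec tb _ (distanceWinners_nonempty tb s R)
  change distanceRule tb s n R ∈ _ at hwin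
  change ∀ r' ∈ _, r' ≠ distanceRule tb s n R → LexPref tb (distanceRule tb s n R) r' at hlex
  rw [h] at hwin hlex
  -- The deviation lowers the score of the reversal at least as much as that of any `r`: by the
  -- triangle inequality the distance drops by at most `(R i).kemenyDist v`, and the reversal
  -- attains this drop at the top of the range.
  have hgain : ∀ r, s ((R i).kemenyDist r) - s (v.kemenyDist r)
      ≤ s ((R i).kemenyDist (R i).rev) - s (v.kemenyDist (R i).rev) := by
    intro r
    have h1 : (R i).kemenyDist (R i).rev = (Fintype.card A).choose 2 := by
      rw [kemenyDist_comm, kemenyDist_rev_self]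
    have h2 : v.kemenyDist (R i).rev
        = (Fintype.card A).choose 2 - (R i).kemenyDist v := by
      have := v.utility_add_kemenyDist (R i)
      rw [kemenyDist_rev_right, kemenyDist_comm (R i) v]
      omega
    rw [h1, h2]
    have := kemenyDist_triangle (R i) v r
    exact hs.sub_le_top (kemenyDist_le _ _) (kemenyDist_le _ _) (by omega) (kemenyDist_le _ _)
  have hsum := fun r => sum_update (fun q => s (q.kemenyDist r)) R i v
  have hwin' : (R i).rev ∈ distanceWinners s (Function.update R i v) := by
    intro r
    have h1 := hsum (R i).rev
    have h2 := hsum r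
    have h3 := hwin r
    have h4 := hgain r
    linarith
  obtain ⟨hwin₂, hlex₂⟩ :=
    lexBest_spec tb _ (distanceWinners_nonempty tb s (Function.update R i v))
  change distanceRule tb s n (Function.update R i v) ∈ _ at hwin₂
  change ∀ r' ∈ _, r' ≠ distanceRule tb s n (Function.update R i v) →
    LexPref tb (distanceRule tb s n (Function.update R i v)) r' at hlex₂
  -- A different new outcome would also have been optimal before the deviation, so each of the two
  -- outcomes would be lexicographically preferred to the other.
  by_contra hne
  have hw : distanceRule tb s n (Function.update R i v) ∈ distanceWinners s R := by
    intro r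
    have h1 := hsum (R i).rev
    have h2 := hsum (distanceRule tb s n (Function.update R i v))
    have h3 := hwin r
    have h4 := hgain (distanceRule tb s n (Function.update R i v))
    have h5 := hwin₂ (R i).rev
    linarith
  exact LexPref.irrefl tb _ ((hlex _ hw hne).trans (hlex₂ _ hwin' (Ne.symm hne)))

theorem incentiveRatio_distanceRule_le (tb : Ranking A) {s : ℕ → ℝ}
    (hs : IsDistanceScoringFunction (Fintype.card A) s) (hM : 1 ≤ (Fintype.card A).choose 2) :
    incentiveRatio (distanceRule tb s) ≤ (((Fintype.card A).choose 2 : ℕ) : ℝ≥0∞) := by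
  refine iSup_le fun n => iSup_le fun R => iSup_le fun i => iSup_le fun v => ?_
  unfold utilityRatio
  split_ifs with h1 h2
  -- The convention `0 / 0 = 1` is where `1 ≤ M` is needed.
  · exact_mod_cast hM
  · exfalso
    apply h2
    have h3 := eq_rev_of_utility_eq_zero h1
    rw [distanceRule_update_of_eq_rev tb hs R i v h3, ← kemenyDist_rev_right, rev_rev,
      kemenyDist_self]
  · refine ENNReal.div_le_of_le_mul ?_
    have h3 := utility_le (R i) (distanceRule tb s n (Function.update R i v))
    have h4 := Nat.one_le_iff_ne_zero.2 h1
    exact_mod_cast h3.trans (Nat.le_mul_of_pos_right _ h4)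

/-! ### Lower bounds from a tie between two rankings. -/

theorem utilityRatio_le_incentiveRatio (f : SWF A) (v v' : Ranking A) (L : List (Ranking A)) :
    utilityRatio (v.utility (f _ (consProfile v' L))) (v.utility (f _ (consProfile v L)))
      ≤ incentiveRatio f := by
  have h : consProfile v' L = Function.update (consProfile v L) 0 v' :=
    (Fin.update_cons_zero _ _ _).symm
  rw [h]
  exact le_iSup_of_le _ (le_iSup_of_le (consProfile v L) (le_iSup_of_le 0 (le_iSup_of_le v' le_rfl)))

/-- If the minimizers of the total score over a list `B` are exactly `tb` and `b`, then many copies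
of `B` leave the choice between `tb` and `b` to two further voters. -/
theorem exists_list_distanceRule_eq (tb : Ranking A) (s : ℕ → ℝ) (B : List (Ranking A))
    (b v v' w : Ranking A)
    (heq : (B.map fun q => s (q.kemenyDist b)).sum = (B.map fun q => s (q.kemenyDist tb)).sum)
    (hlt : ∀ r, r ≠ tb → r ≠ b →
      (B.map fun q => s (q.kemenyDist tb)).sum < (B.map fun q => s (q.kemenyDist r)).sum)
    (hv : s (v.kemenyDist tb) + s (w.kemenyDist tb) ≤ s (v.kemenyDist b) + s (w.kemenyDist b))
    (hv' : s (v'.kemenyDist b) + s (w.kemenyDist b)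
      < s (v'.kemenyDist tb) + s (w.kemenyDist tb)) :
    ∃ L : List (Ranking A), distanceRule tb s _ (consProfile v L) = tb ∧
      distanceRule tb s _ (consProfile v' L) = b := by
  set T : Ranking A → ℝ := fun r => (B.map fun q => s (q.kemenyDist r)).sum with hT
  -- There are finitely many rankings, so one large `K` lets any positive gap in `T` outweigh the
  -- two extra voters.
  have key : ∀ u a : Ranking A, ∀ᶠ K : ℕ in Filter.atTop, ∀ r, T a < T r →
      s (u.kemenyDist a) + s (w.kemenyDist a) + K * T a
        < s (u.kemenyDist r) + s (w.kemenyDist r) + K * T r := by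
    intro u a
    refine Filter.eventually_all.2 fun r => ?_
    by_cases hr : T a < T r
    · have h1 := (tendsto_natCast_atTop_atTop (R := ℝ)).atTop_mul_const (sub_pos.2 hr)
      filter_upwards [h1.eventually_gt_atTop (s (u.kemenyDist a) + s (w.kemenyDist a)
        - (s (u.kemenyDist r) + s (w.kemenyDist r)))] with K hK _
      linarith
    · exact Filter.Eventually.of_forall fun K h => absurd h hr
  obtain ⟨K, hK, hK'⟩ := ((key v tb).and (key v' b)).exists
  have hsum : ∀ u r : Ranking A,
      ∑ i, s ((consProfile u (w :: (List.replicate K B).flatten) i).kemenyDist r)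
        = s (u.kemenyDist r) + s (w.kemenyDist r) + K * T r := by
    intro u r
    rw [sum_consProfile (fun q => s (q.kemenyDist r))]
    simp [hT, List.map_flatten, List.sum_flatten, add_assoc]
  refine ⟨w :: (List.replicate K B).flatten, ?_, ?_⟩
  · refine lexBest_eq_self tb _ fun r => ?_
    rw [hsum, hsum]
    by_cases h1 : r = tb
    · rw [h1]
    by_cases h2 : r = b
    · rw [h2, show T b = T tb from heq]
      linarith
    · exact (hK r (hlt r h1 h2)).le
  · have h := (lexBest_spec tb _ (distanceWinners_nonempty tb s
      (consProfile v' (w :: (List.replicate K B).flatten)))).1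
    change distanceRule tb s _ (consProfile v' (w :: (List.replicate K B).flatten)) ∈ _ at h
    have h0 := h b
    rw [hsum, hsum] at h0
    by_contra hb
    have hbT : T b = T tb := heq
    by_cases h1 : distanceRule tb s _ (consProfile v' (w :: (List.replicate K B).flatten)) = tb
    · rw [h1, hbT] at h0
      linarith
    · have h2 := hlt _ h1 hb
      have h3 := hK' _ (lt_of_eq_of_lt hbT h2)
      linarith

/-- A way to exploit a list whose total score is minimized exactly by `tb` and `b`: flip two
alternatives `x` and `y` that are adjacent in `tb` and ordered differently by `b`. -/
theorem sub_one_le_incentiveRatio (tb : Ranking A) (s : ℕ → ℝ) (B : List (Ranking A))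
    (b : Ranking A) {x y : A} (hxy : tb.prefers x y)
    (hadj : ∀ z, tb.prefers x z → ¬ tb.prefers z y) (hb : b.prefers y x)
    (heq : (B.map fun q => s (q.kemenyDist b)).sum = (B.map fun q => s (q.kemenyDist tb)).sum)
    (hlt : ∀ r, r ≠ tb → r ≠ b →
      (B.map fun q => s (q.kemenyDist tb)).sum < (B.map fun q => s (q.kemenyDist r)).sum)
    (hs₁ : s ((Fintype.card A).choose 2 - 1) + s 1
      ≤ s ((Fintype.card A).choose 2 - (tb.kemenyDist b - 1)) + s (tb.kemenyDist b - 1))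
    (hs₂ : s ((Fintype.card A).choose 2 - tb.kemenyDist b) + s (tb.kemenyDist b - 1)
      < s ((Fintype.card A).choose 2) + s 1) :
    ((tb.kemenyDist b - 1 : ℕ) : ℝ≥0∞) ≤ incentiveRatio (distanceRule tb s) := by
  obtain ⟨t', ht'⟩ := exists_flip tb hxy hadj
  have hself : t'.kemenyDist tb = 1 := by
    rw [kemenyDist_flip ht' hxy, kemenyDist_self]
  have hbt : t'.kemenyDist b = tb.kemenyDist b - 1 := by
    have := ht' b hb
    omega
  have hrev : ∀ q r : Ranking A,
      q.rev.kemenyDist r = (Fintype.card A).choose 2 - q.kemenyDist r := by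
    intro q r
    rw [kemenyDist_rev_left]
    have := q.utility_add_kemenyDist r
    omega
  -- The manipulator is `t'.rev`, who misreports `tb.rev`; the second extra voter `t'` offsets the
  -- truthful report.
  obtain ⟨L, h1, h2⟩ := exists_list_distanceRule_eq tb s B b t'.rev tb.rev t' heq hlt
    (by rwa [hrev, hrev, hself, hbt])
    (by rwa [hrev, hrev, kemenyDist_self, hself, hbt, Nat.sub_zero])
  have h := utilityRatio_le_incentiveRatio (distanceRule tb s) t'.rev tb.rev L
  rw [h1, h2, utility_rev_left, utility_rev_left, hself, hbt] at h
  simpa [utilityRatio] using h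

/-- Permutations of the alternatives act transitively on rankings and preserve the Kemeny distance.
-/
theorem sum_ranking_eq (g : ℕ → ℝ) (r r' : Ranking A) :
    ∑ q : Ranking A, g (q.kemenyDist r) = ∑ q : Ranking A, g (q.kemenyDist r') := by
  obtain ⟨σ, rfl⟩ := exists_relabel_eq r r'
  refine Fintype.sum_equiv (relabelEquiv σ) _ _ fun q => ?_
  change _ = g ((relabel σ q).kemenyDist _)
  rw [kemenyDist_relabel]

theorem sum_rank_eq (p : ℕ → ℝ) (x y : A) :
    ∑ q : Ranking A, p (q.rank x) = ∑ q : Ranking A, p (q.rank y) := by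
  classical
  refine Fintype.sum_equiv (relabelEquiv (Equiv.swap x y)) _ _ fun q => ?_
  change _ = p ((relabel _ q).rank _)
  rw [rank_relabel, Equiv.swap_apply_right]

theorem exists_rank (r : Ranking A) {k : ℕ} (h₁ : 1 ≤ k) (h₂ : k ≤ Fintype.card A) :
    ∃ x, r.rank x = k := by
  have : k ∈ Finset.univ.image r.rank := by
    rw [image_rank]
    exact Finset.mem_Icc.2 ⟨h₁, h₂⟩
  simpa using this

theorem exists_adjacent (r : Ranking A) (h : 2 ≤ Fintype.card A) :
    ∃ x y, r.prefers x y ∧ ∀ z, r.prefers x z → ¬ r.prefers z y := by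
  obtain ⟨x, hx⟩ := exists_rank r (k := 1) le_rfl (by omega)
  obtain ⟨y, hy⟩ := exists_rank r (k := 2) (by omega) h
  refine ⟨x, y, ?_, fun z => ?_⟩
  · rw [prefers_iff_rank_lt]
    omega
  · simp only [prefers_iff_rank_lt]
    omega

/-- Over all rankings every outcome has the same total. Removing `tb` and `tb.rev` subtracts `s d +
s (M - d)`, with `d` the distance from `tb`; for non-affine `s` this is largest exactly at `d = 0`
and `d = M`, so `tb` and `tb.rev` are the only optima. -/
theorem sub_one_le_incentiveRatio_of_not_affine (tb : Ranking A) {s : ℕ → ℝ}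
    (hs : IsDistanceScoringFunction (Fintype.card A) s) (hA : 2 ≤ Fintype.card A)
    (hne : s 1 - s 0 < s ((Fintype.card A).choose 2) - s ((Fintype.card A).choose 2 - 1)) :
    (((Fintype.card A).choose 2 - 1 : ℕ) : ℝ≥0∞) ≤ incentiveRatio (distanceRule tb s) := by
  classical
  have hM : 1 ≤ (Fintype.card A).choose 2 := Nat.choose_pos hA
  obtain ⟨x, y, hxy, hadj⟩ := exists_adjacent tb hA
  have hd : tb.kemenyDist tb.rev = (Fintype.card A).choose 2 := by
    rw [kemenyDist_comm, kemenyDist_rev_self]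
  have htne : tb ≠ tb.rev := fun e => tb.asymm hxy (e ▸ hxy)
  have hsum : ∀ r, ((Finset.univ.filter fun q : Ranking A => q ≠ tb ∧ q ≠ tb.rev).toList.map
      fun q => s (q.kemenyDist r)).sum
      = ∑ q : Ranking A, s (q.kemenyDist tb) - (s (tb.kemenyDist r)
        + s ((Fintype.card A).choose 2 - tb.kemenyDist r)) := by
    intro r
    rw [Finset.sum_map_toList, sum_ranking_eq s tb r]
    have h1 : (Finset.univ.filter fun q : Ranking A => q ≠ tb ∧ q ≠ tb.rev)
        = (Finset.univ.erase tb.rev).erase tb := by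
      ext q
      simp
    have h2 := Finset.add_sum_erase Finset.univ (fun q : Ranking A => s (q.kemenyDist r))
      (Finset.mem_univ tb.rev)
    have h3 := Finset.add_sum_erase (Finset.univ.erase tb.rev)
      (fun q : Ranking A => s (q.kemenyDist r)) (a := tb)
      (Finset.mem_erase.2 ⟨htne, Finset.mem_univ _⟩)
    have h4 : tb.rev.kemenyDist r = (Fintype.card A).choose 2 - tb.kemenyDist r := by
      have := tb.utility_add_kemenyDist r
      rw [kemenyDist_rev_left]
      omega
    rw [h1, ← h2, ← h3, h4]
    ring
  have h := sub_one_le_incentiveRatio tb s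
    (Finset.univ.filter fun q : Ranking A => q ≠ tb ∧ q ≠ tb.rev).toList tb.rev hxy hadj hxy
    (by
      rw [hsum, hsum, hd, kemenyDist_self, Nat.sub_self, Nat.sub_zero, add_comm (s _)])
    (by
      intro r h1 h2
      rw [hsum, hsum, kemenyDist_self, Nat.sub_zero]
      have h3 : 0 < tb.kemenyDist r := by
        rw [Nat.pos_iff_ne_zero, Ne, kemenyDist_eq_zero]
        exact fun e => h1 e.symm
      have h4 : tb.kemenyDist r < (Fintype.card A).choose 2 := by
        have h5 := tb.utility_add_kemenyDist r
        have h6 : tb.utility r ≠ 0 := fun e => h2 (eq_rev_of_utility_eq_zero e)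
        omega
      have := hs.add_compl_lt hne h3 h4
      linarith)
    (by rw [hd, Nat.sub_sub_self hM, add_comm])
    (by
      rw [hd, Nat.sub_self]
      have h1 := hs.strictMono (a := 0) (b := 1) one_pos hM
      have h2 := hs.strictMono (Nat.sub_lt hM one_pos) le_rfl
      linarith)
  rwa [hd] at h

/-! ### Positional scoring rules. -/

theorem prefers_of_score_lt (tb : Ranking A) (p : ℕ → ℝ) {n : ℕ} (R : Profile A n) {x y : A}
    (h : ∑ i, p ((R i).rank x) < ∑ i, p ((R i).rank y)) :
    (positionalRule tb p n R).prefers y x := by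
  have hmem := (lexBest_spec tb _ (positionalWinners_nonempty tb p R)).1
  refine ((positionalRule tb p n R).not_prefers_iff ?_).1 fun h' => ?_
  · rintro rfl
    exact lt_irrefl _ h
  · exact (hmem x y h').not_gt h

/-- Some transposition increases the score difference of an alternative `y` over a worse-ranked
alternative `x`. -/
theorem exists_relabel_gain {p : ℕ → ℝ} (hp : IsPositionalScoringFunction (Fintype.card A) p)
    (hA : 3 ≤ Fintype.card A) (v : Ranking A) :
    ∃ (v' : Ranking A) (x y : A), v.prefers y x ∧
      p (v'.rank x) - p (v.rank x) < p (v'.rank y) - p (v.rank y) := by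
  classical
  have hswap : ∀ x y z, (relabel (Equiv.swap x y) v).rank z = v.rank (Equiv.swap x y z) :=
    fun x y z => rank_relabel _ _ _
  obtain ⟨a, ha⟩ := exists_rank v (k := 1) le_rfl (by omega)
  obtain ⟨c, hc⟩ := exists_rank v (k := Fintype.card A) (by omega) le_rfl
  have hac : a ≠ c := fun e => by rw [e] at ha; omega
  -- Either raising the second-to-last alternative to the top gains points while the last one stays
  -- put, or only the last position loses points, and then dropping the second alternative there
  -- separates it from the first.
  by_cases h : p (Fintype.card A - 1) < p 1
  · obtain ⟨b, hb⟩ := exists_rank v (k := Fintype.card A - 1) (by omega) (by omega)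
    have hbc : b ≠ c := fun e => by rw [e] at hb; omega
    refine ⟨relabel (Equiv.swap a b) v, c, b, ?_, ?_⟩
    · rw [prefers_iff_rank_lt]
      omega
    · rw [hswap, hswap, Equiv.swap_apply_right, Equiv.swap_apply_of_ne_of_ne hac.symm hbc.symm,
        ha, hb]
      linarith
  · obtain ⟨b, hb⟩ := exists_rank v (k := 2) (by omega) (by omega)
    have hab : a ≠ b := fun e => by rw [e] at ha; omega
    refine ⟨relabel (Equiv.swap b c) v, b, a, ?_, ?_⟩
    · rw [prefers_iff_rank_lt]
      omega
    · rw [hswap, hswap, Equiv.swap_apply_left, Equiv.swap_apply_of_ne_of_ne hab hac, hb, hc]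
      have h1 := hp.1 2 (Fintype.card A - 1) (by omega) (by omega) (by omega)
      have h2 := hp.2
      push Not at h
      linarith

theorem incentiveRatio_positionalRule (tb : Ranking A) {p : ℕ → ℝ}
    (hp : IsPositionalScoringFunction (Fintype.card A) p) (hA : 3 ≤ Fintype.card A) :
    incentiveRatio (positionalRule tb p) = ∞ := by
  classical
  obtain ⟨v', x, y, hyx, hgain⟩ := exists_relabel_gain hp hA tb.rev
  -- Together with the truthful voter `tb.rev`, every ranking occurs exactly once, so all
  -- alternatives have equal scores.
  set L := (Finset.univ.erase tb.rev).toList with hL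
  have hsum : ∀ u z, ∑ i, p ((consProfile u L i).rank z)
      = ∑ q : Ranking A, p (q.rank x) + (p (u.rank z) - p (tb.rev.rank z)) := by
    intro u z
    rw [sum_consProfile (fun q => p (q.rank z)), hL, Finset.sum_map_toList, sum_rank_eq p x z,
      ← Finset.add_sum_erase Finset.univ (fun q : Ranking A => p (q.rank z))
        (Finset.mem_univ tb.rev)]
    ring
  have h1 : positionalRule tb p _ (consProfile tb.rev L) = tb := by
    refine lexBest_eq_self tb _ fun z z' _ => ?_
    rw [hsum, hsum]
    simp
  have h2 : (positionalRule tb p _ (consProfile v' L)).prefers y x := by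
    refine prefers_of_score_lt tb p _ ?_
    rw [hsum, hsum]
    linarith
  have h := utilityRatio_le_incentiveRatio (positionalRule tb p) tb.rev v' L
  rw [h1, utility_rev_left tb tb, kemenyDist_self, utilityRatio, if_pos rfl, if_neg, top_le_iff] at h
  · exact h
  · intro h0
    rw [eq_rev_of_utility_eq_zero h0] at h2
    exact tb.asymm hyx h2

end

/-! ### The Kemeny rule: a fence with exactly two optimal rankings. -/

open Ranking

section

variable {A : Type*}

open Classical in
/-- The cost of not ranking `x` above `y`. -/
noncomputable def pairCost (x y : A) (r : Ranking A) : ℕ :=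
  if r.prefers x y then 0 else 2

theorem pairCost_of_prefers {x y : A} {r : Ranking A} (h : r.prefers x y) :
    pairCost x y r = 0 := if_pos h

theorem pairCost_of_prefers' {x y : A} {r : Ranking A} (h : r.prefers y x) :
    pairCost x y r = 2 := if_neg (r.asymm h)

/-- The cost of a cycle of three alternatives; every ranking violates at least one of its pairs. -/
noncomputable def cycleCost (x y z : A) (r : Ranking A) : ℕ :=
  pairCost x y r + pairCost y z r + pairCost z x r

theorem two_le_cycleCost {x y z : A} (r : Ranking A) : 2 ≤ cycleCost x y z r := by
  unfold cycleCost pairCost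
  by_contra h
  have h1 : r.prefers x y ∧ r.prefers y z ∧ r.prefers z x := by
    split_ifs at h <;> first | omega | exact ⟨‹_›, ‹_›, ‹_›⟩
  exact r.asymm (r.trans h1.1 h1.2.1) h1.2.2

/-- Given `y` above `z`, the cycle has only one violated pair precisely when `x` is not between
them. Charging the cycle thus forces `x` to compare alike with `y` and `z`. -/
theorem cycleCost_eq_two {x y z : A} {r : Ranking A} (hyz : r.prefers y z)
    (h : r.prefers x y ↔ r.prefers x z) (hxy : x ≠ y) (hxz : x ≠ z) : cycleCost x y z r = 2 := by
  unfold cycleCost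
  rw [pairCost_of_prefers hyz]
  rcases r.total hxy with h' | h'
  · rw [pairCost_of_prefers h', pairCost_of_prefers' (h.1 h')]
  · rw [pairCost_of_prefers' h', pairCost_of_prefers]
    refine (r.not_prefers_iff hxz).1 fun h1 => ?_
    exact r.asymm h' (h.2 h1)

theorem prefers_iff_of_cycleCost_eq_two {x y z : A} {r : Ranking A} (hyz : r.prefers y z)
    (h : cycleCost x y z r = 2) : r.prefers x y ↔ r.prefers x z := by
  refine ⟨fun h' => r.trans h' hyz, fun h' => ?_⟩
  by_contra hn
  unfold cycleCost at h
  rw [pairCost_of_prefers hyz, pairCost_of_prefers' h', pairCost, if_neg hn] at h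
  omega

/-- Two indices are neighbours on the path and `i` is the odd one. -/
def FenceEdge (i j : ℕ) : Prop := (j = i + 1 ∨ i = j + 1) ∧ i % 2 = 1

/-- The key of the linear extension of the fence that is increasing on pairs of indices which are
not neighbours. -/
def incKey (i : ℕ) : ℤ := 2 * i - 3 * (i % 2 : ℕ)

/-- The key of the linear extension of the fence that is decreasing on pairs of indices which are
not neighbours. -/
def decKey (i : ℕ) : ℤ := -2 * i - 3 * (i % 2 : ℕ)

theorem incKey_injective : Function.Injective incKey := by
  intro i j h
  unfold incKey at h
  omega

theorem decKey_injective : Function.Injective decKey := by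
  intro i j h
  unfold decKey at h
  omega

/-- A relation on non-neighbouring pairs of indices that is preserved when one of the two indices
moves to a neighbour is constant. -/
theorem iff_of_neighbour_iff {m : ℕ} {D : ℕ → ℕ → Prop}
    (hr : ∀ i j, i + 2 ≤ j → j + 1 < m → (D i j ↔ D i (j + 1)))
    (hl : ∀ i j, i + 3 ≤ j → j < m → (D i j ↔ D (i + 1) j)) {i j : ℕ} (hij : i + 2 ≤ j)
    (hj : j < m) : D i j ↔ D 0 (m - 1) := by
  have h1 : ∀ k, j + k < m → (D i j ↔ D i (j + k)) := by
    intro k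
    induction k with
    | zero => simp
    | succ k ih => exact fun h => (ih (by omega)).trans (hr i (j + k) (by omega) h)
  have h2 : ∀ k, k + 2 ≤ m - 1 → (D k (m - 1) ↔ D 0 (m - 1)) := by
    intro k
    induction k with
    | zero => simp
    | succ k ih =>
      exact fun h => (hl k (m - 1) (by omega) (by omega)).symm.trans (ih (by omega))
  have h3 := h1 (m - 1 - j) (by omega)
  rw [Nat.add_sub_cancel' (by omega)] at h3
  exact h3.trans (h2 i (by omega))

theorem FenceEdge.ne {idx : A → ℕ} {x y : A} (h : FenceEdge (idx x) (idx y)) : x ≠ y := by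
  rintro rfl
  obtain ⟨h | h, -⟩ := h <;> omega

end

section

variable {A : Type*} [Fintype A]

/-- `T` is, up to a constant, the total Kemeny distance to the rankings of some list. -/
def IsTotalDistance (T : Ranking A → ℕ) : Prop :=
  ∃ (L : List (Ranking A)) (c : ℕ), ∀ r, (L.map fun q => q.kemenyDist r).sum = T r + c

theorem IsTotalDistance.add {T T' : Ranking A → ℕ} (h : IsTotalDistance T)
    (h' : IsTotalDistance T') : IsTotalDistance fun r => T r + T' r := by
  obtain ⟨L, c, hL⟩ := h
  obtain ⟨L', c', hL'⟩ := h'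
  refine ⟨L ++ L', c + c', fun r => ?_⟩
  rw [List.map_append, List.sum_append, hL, hL']
  ring

theorem IsTotalDistance.sum {κ : Type*} (S : Finset κ) {T : κ → Ranking A → ℕ}
    (h : ∀ k ∈ S, IsTotalDistance (T k)) : IsTotalDistance fun r => ∑ k ∈ S, T k r := by
  classical
  induction S using Finset.induction_on with
  | empty => exact ⟨[], 0, by simp⟩
  | insert a S ha ih =>
    simp only [Finset.sum_insert ha]
    exact (h a (Finset.mem_insert_self a S)).add
      (ih fun k hk => h k (Finset.mem_insert_of_mem hk))

/-- Two voters suffice: both put `x` above `y` and they order every other pair oppositely, so the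
other pairs contribute a constant. -/
theorem isTotalDistance_pairCost (tb : Ranking A) {x y : A} (hxy : x ≠ y) :
    IsTotalDistance (pairCost x y) := by
  classical
  let k : A → ℕ := fun z => if z = x then 0 else if z = y then 1 else tb.rank z + 2
  have hk : Function.Injective k := by
    intro u v h
    have : tb.rank u = tb.rank v → u = v := fun e => tb.rank_injective e
    simp only [k] at h
    grind
  have hx : k x = 0 := by simp [k]
  have hy : k y = 1 := by simp [k, hxy.symm]
  have hq : (ofKey k hk).prefers x y := by
    change k x < k y
    omega
  obtain ⟨t', ht'⟩ := exists_flip (ofKey k hk) hq fun z h1 h2 => by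
    change k x < k z at h1
    change k z < k y at h2
    omega
  have hM : 1 ≤ (Fintype.card A).choose 2 := by
    have h1 := kemenyDist_flip ht' hq
    have h2 := kemenyDist_le t' (ofKey k hk)
    omega
  refine ⟨[ofKey k hk, t'.rev], (Fintype.card A).choose 2 - 1, fun r => ?_⟩
  simp only [List.map_cons, List.map_nil, List.sum_cons, List.sum_nil, add_zero]
  rw [kemenyDist_rev_left]
  have h1 := t'.utility_add_kemenyDist r
  rcases r.total hxy with h | h
  · rw [pairCost_of_prefers h]
    have := kemenyDist_flip ht' h
    omega
  · rw [pairCost_of_prefers' h]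
    have := ht' r h
    omega

open Classical in
/-- The total cost whose minimizers are the two linear extensions of the fence given by `incKey`
and `decKey`. -/
noncomputable def fenceCost (idx : A → ℕ) (r : Ranking A) : ℕ :=
  ∑ p ∈ Finset.univ.filter fun p : A × A => FenceEdge (idx p.1) (idx p.2), pairCost p.1 p.2 r
  + ∑ t ∈ Finset.univ.filter fun t : A × A × A => FenceEdge (idx t.2.1) (idx t.2.2) ∧
      (idx t.1 + 2 ≤ idx t.2.1 ∧ idx t.1 + 2 ≤ idx t.2.2 ∨
        idx t.2.1 + 2 ≤ idx t.1 ∧ idx t.2.2 + 2 ≤ idx t.1), cycleCost t.1 t.2.1 t.2.2 r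

theorem isTotalDistance_fenceCost (tb : Ranking A) (idx : A → ℕ) :
    IsTotalDistance (fenceCost idx) := by
  classical
  refine IsTotalDistance.add (IsTotalDistance.sum _ fun p hp => ?_)
    (IsTotalDistance.sum _ fun t ht => ?_)
  · exact isTotalDistance_pairCost tb (Finset.mem_filter.1 hp).2.ne
  · obtain ⟨-, h, h'⟩ := Finset.mem_filter.1 ht
    have h1 : t.1 ≠ t.2.1 := fun e => by rw [e] at h'; omega
    have h2 : t.2.2 ≠ t.1 := fun e => by rw [e] at h'; omega
    exact ((isTotalDistance_pairCost tb h1).add (isTotalDistance_pairCost tb h.ne)).add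
      (isTotalDistance_pairCost tb h2)

open Classical in
-- Such an `a` attains the minimum of every summand separately (0 on edges, 2 on cycles), so any
-- other minimizer must do so as well and inherits both properties.
theorem fenceCost_le_of_forall {idx : A → ℕ} {a : Ranking A}
    (h₁ : ∀ x y, FenceEdge (idx x) (idx y) → a.prefers x y)
    (h₂ : ∀ x y z, FenceEdge (idx y) (idx z) →
      (idx x + 2 ≤ idx y ∧ idx x + 2 ≤ idx z ∨ idx y + 2 ≤ idx x ∧ idx z + 2 ≤ idx x) →
      (a.prefers x y ↔ a.prefers x z)) (r : Ranking A) :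
    fenceCost idx a ≤ fenceCost idx r ∧ (fenceCost idx r ≤ fenceCost idx a →
      (∀ x y, FenceEdge (idx x) (idx y) → r.prefers x y) ∧
      (∀ x y z, FenceEdge (idx y) (idx z) →
      (idx x + 2 ≤ idx y ∧ idx x + 2 ≤ idx z ∨ idx y + 2 ≤ idx x ∧ idx z + 2 ≤ idx x) →
      (r.prefers x y ↔ r.prefers x z))) := by
  have hA : ∀ p ∈ Finset.univ.filter fun p : A × A => FenceEdge (idx p.1) (idx p.2),
      pairCost p.1 p.2 a ≤ pairCost p.1 p.2 r := by
    intro p hp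
    rw [pairCost_of_prefers (h₁ _ _ (Finset.mem_filter.1 hp).2)]
    exact Nat.zero_le _
  have hB : ∀ t ∈ Finset.univ.filter fun t : A × A × A => FenceEdge (idx t.2.1) (idx t.2.2) ∧
      (idx t.1 + 2 ≤ idx t.2.1 ∧ idx t.1 + 2 ≤ idx t.2.2 ∨
        idx t.2.1 + 2 ≤ idx t.1 ∧ idx t.2.2 + 2 ≤ idx t.1),
      cycleCost t.1 t.2.1 t.2.2 a = 2 := by
    intro t ht
    obtain ⟨-, h, h'⟩ := Finset.mem_filter.1 ht
    refine cycleCost_eq_two (h₁ _ _ h) (h₂ _ _ _ h h') ?_ ?_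
    · exact fun e => by rw [e] at h'; omega
    · exact fun e => by rw [e] at h'; omega
  have hB' := fun t ht => (hB t ht).trans_le (two_le_cycleCost (x := t.1) (y := t.2.1)
    (z := t.2.2) r)
  have hsA := Finset.sum_le_sum hA
  have hsB := Finset.sum_le_sum hB'
  refine ⟨add_le_add hsA hsB, fun hle => ?_⟩
  have heA := (Finset.sum_eq_sum_iff_of_le hA).1 (by unfold fenceCost at hle; omega)
  have heB := (Finset.sum_eq_sum_iff_of_le hB').1 (by unfold fenceCost at hle; omega)
  have hr₁ : ∀ x y, FenceEdge (idx x) (idx y) → r.prefers x y := by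
    intro x y hxy
    have h := heA (x, y) (by simpa using hxy)
    rw [pairCost_of_prefers (h₁ _ _ hxy)] at h
    by_contra hn
    simp [pairCost, hn] at h
  refine ⟨hr₁, fun x y z hyz hx => ?_⟩
  have hmem : (x, y, z) ∈ Finset.univ.filter fun t : A × A × A =>
        FenceEdge (idx t.2.1) (idx t.2.2) ∧
        (idx t.1 + 2 ≤ idx t.2.1 ∧ idx t.1 + 2 ≤ idx t.2.2 ∨
          idx t.2.1 + 2 ≤ idx t.1 ∧ idx t.2.2 + 2 ≤ idx t.1) :=
      Finset.mem_filter.2 ⟨Finset.mem_univ _, hyz, hx⟩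
  exact prefers_iff_of_cycleCost_eq_two (hr₁ y z hyz) <| (heB _ hmem).symm.trans (hB _ hmem)

/-- Every minimizer of the fence cost is one of the two linear extensions `a` and `b`. -/
theorem eq_or_eq_of_fence {idx : A → ℕ} (hidx : Function.Injective idx) {m : ℕ}
    (hlt : ∀ x, idx x < m) (hsurj : ∀ i < m, ∃ x, idx x = i) {a b r : Ranking A}
    (ha : ∀ x y, a.prefers x y ↔ incKey (idx x) < incKey (idx y))
    (hb : ∀ x y, b.prefers x y ↔ decKey (idx x) < decKey (idx y))
    (h₁ : ∀ x y, FenceEdge (idx x) (idx y) → r.prefers x y)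
    (h₂ : ∀ x y z, FenceEdge (idx y) (idx z) →
      (idx x + 2 ≤ idx y ∧ idx x + 2 ≤ idx z ∨ idx y + 2 ≤ idx x ∧ idx z + 2 ≤ idx x) →
      (r.prefers x y ↔ r.prefers x z)) : r = a ∨ r = b := by
  let D : ℕ → ℕ → Prop := fun i j => ∃ x y, idx x = i ∧ idx y = j ∧ r.prefers x y
  have hD : ∀ x y, r.prefers x y ↔ D (idx x) (idx y) := by
    intro x y
    refine ⟨fun h => ⟨x, y, rfl, rfl, h⟩, ?_⟩
    rintro ⟨x', y', hx, hy, h⟩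
    rwa [hidx hx, hidx hy] at h
  have hn : ∀ x y z, (idx z = idx y + 1 ∨ idx y = idx z + 1) →
      (idx x + 2 ≤ idx y ∧ idx x + 2 ≤ idx z ∨ idx y + 2 ≤ idx x ∧ idx z + 2 ≤ idx x) →
      (r.prefers x y ↔ r.prefers x z) := by
    intro x y z hyz hx
    rcases Nat.mod_two_eq_zero_or_one (idx y) with h | h
    · exact (h₂ x z y ⟨hyz.symm, by omega⟩ (by omega)).symm
    · exact h₂ x y z ⟨hyz, h⟩ hx
  -- The cycles propagate one decision to all non-neighbouring pairs. The edges being fixed, this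
  -- single bit determines `r`.
  have hconst : ∀ x y, idx x + 2 ≤ idx y → (r.prefers x y ↔ D 0 (m - 1)) := by
    intro x y hxy
    rw [hD]
    refine iff_of_neighbour_iff (m := m) ?_ ?_ hxy (hlt y)
    · intro i j hij hj
      obtain ⟨u, rfl⟩ := hsurj i (by omega)
      obtain ⟨v, rfl⟩ := hsurj j (by omega)
      obtain ⟨w, hw⟩ := hsurj (idx v + 1) hj
      rw [← hw, ← hD, ← hD]
      exact hn u v w (by omega) (by omega)
    · intro i j hij hj
      obtain ⟨u, rfl⟩ := hsurj i (by omega)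
      obtain ⟨v, rfl⟩ := hsurj j (by omega)
      obtain ⟨w, hw⟩ := hsurj (idx u + 1) (by omega)
      rw [← hw, ← hD, ← hD]
      have h := hn v u w (by omega) (by omega)
      have hvu : v ≠ u := fun e => by rw [e] at hij; omega
      have hvw : v ≠ w := fun e => by rw [e] at hij; omega
      rw [← r.not_prefers_iff hvu, ← r.not_prefers_iff hvw, h]
  by_cases hd : D 0 (m - 1)
  · refine Or.inl (eq_of_imp (r := a) fun x y h => ?_).symm
    rw [ha] at h
    unfold incKey at h
    by_cases hxy : idx x + 2 ≤ idx y
    · exact (hconst x y hxy).2 hd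
    · exact h₁ x y ⟨by omega, by omega⟩
  · refine Or.inr (eq_of_imp (r := b) fun x y h => ?_).symm
    have hne := b.ne_of_prefers h
    rw [hb] at h
    unfold decKey at h
    by_cases hxy : idx y + 2 ≤ idx x
    · exact (r.not_prefers_iff hne.symm).1 fun h' => hd ((hconst y x hxy).1 h')
    · exact h₁ x y ⟨by omega, by omega⟩

/-- The two linear extensions of the fence agree on its edges only. -/
theorem utility_fence_le {idx : A → ℕ} (hidx : Function.Injective idx) {m : ℕ}
    (hlt : ∀ x, idx x < m) {a b : Ranking A}
    (ha : ∀ x y, a.prefers x y ↔ incKey (idx x) < incKey (idx y))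
    (hb : ∀ x y, b.prefers x y ↔ decKey (idx x) < decKey (idx y)) :
    a.utility b ≤ m - 1 := by
  unfold utility
  rw [← Finset.card_range (m - 1)]
  -- Agreeing pairs are edges; an edge is determined by its smaller index, and its orientation by
  -- parity.
  refine Finset.card_le_card_of_injOn (fun p => min (idx p.1) (idx p.2)) ?_ ?_
  · rintro ⟨x, y⟩ h
    simp only [Finset.coe_filter, Set.mem_ofPred_eq, Finset.mem_univ, true_and, ha, hb, incKey,
      decKey] at h
    have h1 := hlt x
    have h2 := hlt y
    simp only [Finset.coe_range, Set.mem_Iio]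
    omega
  · rintro ⟨x, y⟩ h ⟨x', y'⟩ h' heq
    simp only [Finset.coe_filter, Set.mem_ofPred_eq, Finset.mem_univ, true_and, ha, hb, incKey,
      decKey] at h h' heq
    rw [Prod.mk.injEq]
    exact ⟨hidx (by omega), hidx (by omega)⟩

/-- The path is numbered to fit the given tie-breaking ranking, which has to be one of the two
optima. -/
theorem exists_fence_index (tb : Ranking A) {m : ℕ} (hm : Fintype.card A = m) :
    ∃ idx : A → ℕ, Function.Injective idx ∧ (∀ x, idx x < m) ∧ (∀ i < m, ∃ x, idx x = i) ∧
      ∀ x y, tb.prefers x y ↔ incKey (idx x) < incKey (idx y) := by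
  let e := Fintype.equivFinOfCardEq hm
  obtain ⟨σ, hσ⟩ := exists_relabel_eq (ofKey (fun x => incKey (e x))
    (incKey_injective.comp (Fin.val_injective.comp e.injective))) tb
  refine ⟨fun x => e (σ x), Fin.val_injective.comp (e.injective.comp σ.injective),
    fun x => (e (σ x)).2, fun i hi => ⟨σ.symm (e.symm ⟨i, hi⟩), by simp⟩, fun x y => ?_⟩
  rw [← hσ]
  rfl

theorem sub_card_le_incentiveRatio_kemenyRule (tb : Ranking A) {m : ℕ}
    (hm : Fintype.card A = m) (h4 : 4 ≤ m) :
    ((m.choose 2 - m : ℕ) : ℝ≥0∞) ≤ incentiveRatio (kemenyRule tb) := by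
  obtain ⟨idx, hidx, hlt, hsurj, ha⟩ := exists_fence_index tb hm
  let b : Ranking A := ofKey (fun x => decKey (idx x)) (decKey_injective.comp hidx)
  have hb : ∀ x y, b.prefers x y ↔ decKey (idx x) < decKey (idx y) := fun _ _ => Iff.rfl
  -- The offset 3 in the keys lies strictly between 2 and 6: it carries an odd index past an
  -- adjacent even one, but not past an even one three steps away.
  have hmin := fenceCost_le_of_forall (idx := idx) (a := tb)
    (fun x y h => by
      obtain ⟨h, h'⟩ := h
      rw [ha]
      unfold incKey
      omega)
    (fun x y z h h' => by
      obtain ⟨h, h''⟩ := h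
      rw [ha, ha]
      unfold incKey
      omega)
  have hmin' := fenceCost_le_of_forall (idx := idx) (a := b)
    (fun x y h => by
      obtain ⟨h, h'⟩ := h
      rw [hb]
      unfold decKey
      omega)
    (fun x y z h h' => by
      obtain ⟨h, h''⟩ := h
      rw [hb, hb]
      unfold decKey
      omega)
  obtain ⟨B, c, hB⟩ := isTotalDistance_fenceCost tb idx
  have hBr : ∀ r, (B.map fun q => ((q.kemenyDist r : ℕ) : ℝ)).sum = (fenceCost idx r + c : ℕ) := by
    intro r
    rw [← hB r, Nat.cast_list_sum, List.map_map]
    rfl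
  have hu := utility_fence_le hidx hlt ha hb
  have hud := tb.utility_add_kemenyDist b
  rw [hm] at hud
  -- Indices 0 and 3 have `incKey` 0 and 3, with no key strictly between, and are not neighbours on
  -- the path; hence they are adjacent in `tb` and swapped in `b`. This needs `4 ≤ m`.
  obtain ⟨x, hx⟩ := hsurj 0 (by omega)
  obtain ⟨y, hy⟩ := hsurj 3 (by omega)
  have hyx : b.prefers y x := by
    rw [hb, hx, hy]
    norm_num [decKey]
  have hxy : tb.prefers x y := by
    rw [ha, hx, hy]
    norm_num [incKey]
  have hpos : 1 ≤ tb.kemenyDist b := by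
    rw [Nat.one_le_iff_ne_zero, Ne, kemenyDist_eq_zero]
    exact fun e => b.asymm hyx (e ▸ hxy)
  have h := sub_one_le_incentiveRatio tb (fun x => (x : ℝ)) B b hxy
    (fun z h1 h2 => by
      rw [ha, hx] at h1
      rw [ha, hy] at h2
      unfold incKey at h1 h2
      omega) hyx
    (by
      rw [hBr, hBr]
      exact_mod_cast congrArg (· + c) (le_antisymm (hmin' tb).1 (hmin b).1))
    (fun r h1 h2 => by
      rw [hBr, hBr, Nat.cast_lt, Nat.add_lt_add_iff_right]
      by_contra hn
      obtain ⟨h3, h4⟩ := (hmin r).2 (not_lt.1 hn)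
      exact (eq_or_eq_of_fence hidx hlt hsurj ha hb h3 h4).elim h1 h2)
    -- For the identity score the first comparison is an equality, so `tb` survives only through
    -- tie-breaking.
    (by
      rw [hm]
      norm_cast
      omega)
    (by
      rw [hm]
      norm_cast
      omega)
  rw [kemenyRule_eq_distanceRule]
  refine le_trans ?_ h
  rw [Nat.cast_le]
  omega

end

theorem theorem3 {A : Type*} [Fintype A] (m : ℕ) (hm : Fintype.card A = m) (tb : Ranking A) :
    (4 ≤ m →
      ((m.choose 2 - m : ℕ) : ℝ≥0∞) ≤ incentiveRatio (kemenyRule tb) ∧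
        incentiveRatio (kemenyRule tb) ≤ ((m.choose 2 : ℕ) : ℝ≥0∞)) ∧
    (3 ≤ m → ∀ f : SWF A, IsDistanceScoringRule tb f → f ≠ kemenyRule tb →
      ((m.choose 2 - 1 : ℕ) : ℝ≥0∞) ≤ incentiveRatio f ∧
        incentiveRatio f ≤ ((m.choose 2 : ℕ) : ℝ≥0∞)) ∧
    (3 ≤ m → ∀ f : SWF A, IsPositionalScoringRule tb f → incentiveRatio f = ∞) := by
  subst hm
  refine ⟨fun h4 => ⟨sub_card_le_incentiveRatio_kemenyRule tb rfl h4, ?_⟩, ?_, ?_⟩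
  · rw [kemenyRule_eq_distanceRule]
    exact incentiveRatio_distanceRule_le tb (isDistanceScoringFunction_natCast _)
      (Nat.choose_pos (by omega))
  · rintro h3 f ⟨s, hs, rfl⟩ hne
    have hM : 1 ≤ (Fintype.card A).choose 2 := Nat.choose_pos (by omega)
    refine ⟨sub_one_le_incentiveRatio_of_not_affine tb hs (by omega) ?_,
      incentiveRatio_distanceRule_le tb hs hM⟩
    by_contra h
    exact hne (distanceRule_eq_kemenyRule tb hs hM (not_lt.1 h))
  · rintro h3 f ⟨p, hp, rfl⟩
    exact incentiveRatio_positionalRule tb hp h3
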